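/- Let $(X,d,\mu)$ be a coarse median space: $(X,d)$ is a metric space and $\mu\colon X^3\to X$ is a ternary operation such that - (M1) $\mu(a,a,b)=a$, and (M2) $\mu$ is invariant under all permutations of its arguments; - (C1) there are constants $K,H_0\geq 0$ with $d(\mu(a,b,c),\mu(a',b',c'))\leq K\,(d(a,a')+d(b,b')+d(c,c'))+H_0$ for all $a,b,c,a',b',c'\in X$; - (C2) there is a function $H\colon\mathbb N\to[0,\infty)$ such that for every finite $A\subseteq X$ with $1\leq|A|\leq p$ there are a finite median algebra $(\Pi,\mu_\Pi)$ and maps $\pi\colon A\to\Pi$, $\lambda\colon\Pi\to X$ with $d(\lambda\mu_\Pi(x,y,z),\mu(\lambda x,\lambda y,\lambda z))\leq H(p)$ for all $x,y,z\in\Pi$ and $d(\lambda\pi a,a)\leq H(p)$ for all $a\in A$. Here a median algebra is a set with a ternary operation $m$ satisfying $m(a,a,b)=a$, invariance under permutations of the arguments, and $m(m(a,b,c),b,d)=m(a,b,m(c,b,d))$; its rank is the supremum of the $n$ for which it contains a subalgebra isomorphic to the cube $\{0,1\}^n$ with coordinatewise majority vote. The space $(X,d,\mu)$ has rank at most $n$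 if, for some choice of $H$, the algebras $\Pi$ in (C2) can always be chosen of rank at most $n$. Suppose that $(X,d)$ is geodesic (any two points $x,y$ are joined by an isometric embedding of $[0,d(x,y)]$) and that $(X,d,\mu)$ has rank at most $1$. Then $(X,d)$ is Gromov hyperbolic: there is $\delta\geq0$ such that in every geodesic triangle in $X$ each side is contained in the closed $\delta$-neighbourhood of the union of the other two sides. -/

import Mathlib

namespace CoarseMedian

/-- `(P, m)` is a median algebra: localisation, symmetry (under two transpositions, which generate
all permutations of the three arguments) and the 4-point condition. -/
structure IsMedianAlgebra {P : Type*} (m : P → P → P → P) : Prop where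
  localisation : ∀ a b, m a a b = a
  symm_left : ∀ a b c, m a b c = m b a c
  symm_right : ∀ a b c, m a b c = m a c b
  four_point : ∀ a b c d, m (m a b c) b d = m a b (m c b d)

/-- Majority vote among three elements of the two-element set. -/
def majority (a b c : Bool) : Bool := (a && b) || (b && c) || (c && a)

/-- The median operator of the median `n`-cube: majority vote on each coordinate. -/
def cubeMedian (n : ℕ) (x y z : Fin n → Bool) : Fin n → Bool :=
  fun i => majority (x i) (y i) (z i)

/-- `(P, m)` has a subalgebra isomorphic to the median `n`-cube, namely the image of an injective
homomorphism from the `n`-cube. -/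
def ContainsCube {P : Type*} (m : P → P → P → P) (n : ℕ) : Prop :=
  ∃ f : (Fin n → Bool) → P, Function.Injective f ∧
    ∀ x y z, f (cubeMedian n x y z) = m (f x) (f y) (f z)

/-- The rank of a median algebra: the supremum of the `n` for which it contains an `n`-cube. -/
noncomputable def medianRank {P : Type*} (m : P → P → P → P) : ℕ∞ :=
  ⨆ (n : ℕ) (_ : ContainsCube m n), (n : ℕ∞)

/-- The finite set `A ⊆ X` is approximated, up to the error `h`, by the finite median algebra
`(P, m)` through the maps `p : A → P` and `l : P → X`. -/
structure IsApproximation {X : Type*} [MetricSpace X] (μ : X → X → X → X) (A : Finset X) (h : ℝ)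
    {P : Type*} (m : P → P → P → P) (p : A → P) (l : P → X) : Prop where
  finite : Finite P
  median : IsMedianAlgebra m
  quasi_morphism : ∀ x y z : P, dist (l (m x y z)) (μ (l x) (l y) (l z)) ≤ h
  close : ∀ a : A, dist (l (p a)) (a : X) ≤ h

/-- `(X, d, μ)` is a coarse median space: (M1), (M2), (C1) with an affine control function
`t ↦ K * t + H₀`, and (C2) with an error bound `H` depending only on the cardinality. -/
structure IsCoarseMedianSpace (X : Type*) [MetricSpace X] (μ : X → X → X → X) : Prop where
  localisation : ∀ a b, μ a a b = a
  symm_left : ∀ a b c, μ a b c = μ b a c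
  symm_right : ∀ a b c, μ a b c = μ a c b
  control : ∃ K H₀ : ℝ, 0 ≤ K ∧ 0 ≤ H₀ ∧ ∀ a b c a' b' c' : X,
    dist (μ a b c) (μ a' b' c') ≤ K * (dist a a' + dist b b' + dist c c') + H₀
  approx : ∃ H : ℕ → ℝ, (∀ k, 0 ≤ H k) ∧
    ∀ (k : ℕ) (A : Finset X), A.Nonempty → A.card ≤ k →
      ∃ (P : Type) (m : P → P → P → P) (p : A → P) (l : P → X),
        IsApproximation μ A (H k) m p l

/-- The coarse median space `(X, d, μ)` has rank at most `n`: the approximating finite median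
algebras in (C2) can always be chosen of rank at most `n`. -/
def RankAtMost (X : Type*) [MetricSpace X] (μ : X → X → X → X) (n : ℕ) : Prop :=
  ∃ H : ℕ → ℝ, (∀ k, 0 ≤ H k) ∧
    ∀ (k : ℕ) (A : Finset X), A.Nonempty → A.card ≤ k →
      ∃ (P : Type) (m : P → P → P → P) (p : A → P) (l : P → X),
        IsApproximation μ A (H k) m p l ∧ medianRank m ≤ (n : ℕ∞)

/-- The restriction of `γ` to `[0, d(x, y)]` is a geodesic from `x` to `y`. -/
structure IsGeodesic {X : Type*} [MetricSpace X] (γ : ℝ → X) (x y : X) : Prop where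
  source : γ 0 = x
  target : γ (dist x y) = y
  isometric : ∀ s ∈ Set.Icc 0 (dist x y), ∀ t ∈ Set.Icc 0 (dist x y),
    dist (γ s) (γ t) = |s - t|

/-- Any two points of `X` are joined by a geodesic. -/
def IsGeodesicSpace (X : Type*) [MetricSpace X] : Prop :=
  ∀ x y : X, ∃ γ : ℝ → X, IsGeodesic γ x y

/-- Gromov hyperbolicity of a geodesic space: for some `δ`, all geodesic triangles are `δ`-slim,
i.e. each side lies in the `δ`-neighbourhood of the union of the two others. (It is enough to say
this for the side from `x` to `y`, since all triangles with all labellings are considered.) -/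
def IsHyperbolic (X : Type*) [MetricSpace X] : Prop :=
  ∃ δ : ℝ, 0 ≤ δ ∧ ∀ (x y z : X) (α β γ : ℝ → X),
    IsGeodesic α x y → IsGeodesic β y z → IsGeodesic γ x z →
      ∀ s ∈ Set.Icc 0 (dist x y),
        (∃ t ∈ Set.Icc 0 (dist y z), dist (α s) (β t) ≤ δ) ∨
        (∃ t ∈ Set.Icc 0 (dist x z), dist (α s) (γ t) ≤ δ)

end CoarseMedian

/-! A median algebra without a square behaves like a tree: triangles are tripods, and points with
different projections to an interval are joined only through that interval. Models of at most five
points carry these facts to `X` with uniform error.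

Hence coarse intervals form thin triangles (`exists_thin`), and it remains to compare them with
geodesics. A geodesic stays near its coarse interval because projection is contracting: far from the
interval it moves less than the geodesic advances (`exists_geodesic_close`). Conversely, the
projected geodesic cannot jump over a point of the interval, so it passes near each of them
(`exists_interval_close`). -/

namespace CoarseMedian

/-! ### Median algebras of rank at most one -/

namespace IsMedianAlgebra

variable {P : Type*} {m : P → P → P → P}

theorem rotate (hm : IsMedianAlgebra m) (a b c : P) : m a b c = m b c a := by
  rw [hm.symm_left, hm.symm_right]

theorem swap (hm : IsMedianAlgebra m) (a b c : P) : m a b c = m c b a := by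
  rw [hm.rotate, hm.symm_left]

theorem loc_outer (hm : IsMedianAlgebra m) (a b : P) : m a b a = a := by
  rw [hm.symm_right, hm.localisation]

theorem loc_right (hm : IsMedianAlgebra m) (a b : P) : m b a a = a := by
  rw [hm.rotate, hm.localisation]

/-- The median of `a`, `x`, `c` lies between `a` and `x`. -/
theorem median_mem (hm : IsMedianAlgebra m) (a c x : P) : m a x (m a c x) = m a c x := by
  have h := hm.four_point c a x x
  rw [hm.loc_outer x a] at h
  calc m a x (m a c x) = m (m c a x) a x := by rw [hm.symm_left c a x, ← hm.rotate]
    _ = m a c x := by rw [h, hm.symm_left]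

/-- If `p` lies between `a` and `q`, and `q` between `a` and `b`, then `q` lies between `p` and
`b`. -/
theorem chain (hm : IsMedianAlgebra m) {a b p q : P} (hp : m a q p = p) (hq : m a b q = q) :
    m p b q = q := by
  have h := hm.four_point p q a b
  rw [show m p q a = p by rw [hm.swap, hp], show m a q b = q by rw [hm.symm_right, hq],
    hm.loc_right] at h
  rw [hm.symm_right, h]

/-- A point lying between each two of three points is their median. -/
theorem eq_median (hm : IsMedianAlgebra m) {a b c p : P} (hab : m a b p = p)
    (hac : m a c p = p) (hbc : m b c p = p) : p = m a b c := by
  have key : ∀ a b c : P, m a b p = p → m a c p = p → m a (m a b c) p = p := by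
    intro a b c h1 h2
    have h := hm.four_point b a c p
    rw [hm.symm_left c a p, h2, hm.symm_left b a p, h1, hm.symm_left b a c] at h
    rw [hm.symm_left, h]
  have h1 := key a b c hab hac
  have h2 := key b a c (by rw [hm.symm_left, hab]) hbc
  rw [hm.symm_left b a c] at h2
  have hq : m a b (m a b c) = m a b c := by
    rw [hm.symm_right a b c, hm.median_mem]
  -- The median lies between `p` and `b`, and `p` between `b` and the median, so they coincide.
  have h3 := hm.chain h1 hq
  rw [← h3, hm.rotate, h2]

/-- Four points in the position of the vertices of a square span a `2`-cube. -/
theorem containsCube_two (hm : IsMedianAlgebra m) {x p q r : P} (hx : m p q x = x)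
    (hr : m p q r = r) (hp : m x r p = p) (hq : m x r q = q) (hxp : x ≠ p) (hxq : x ≠ q) :
    ContainsCube m 2 := by
  have hpq : p ≠ q := by
    rintro rfl
    exact hxp (by rw [← hx, hm.localisation])
  have hxr : x ≠ r := by
    rintro rfl
    exact hxp (by rw [← hp, hm.localisation])
  have hpr : p ≠ r := by
    rintro rfl
    exact hxq (by rw [← hx, hm.rotate, hm.swap, hm.symm_left, hq])
  have hqr : q ≠ r := by
    rintro rfl
    exact hxp (by rw [← hx, hm.swap, hp])
  let g : Bool → Bool → P := fun i j => bif i then (bif j then r else p) else bif j then q else x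
  have perm : ∀ a b c d : P, m a b c = d →
      m a c b = d ∧ m b a c = d ∧ m b c a = d ∧ m c a b = d ∧ m c b a = d := by
    rintro a b c d rfl
    refine ⟨(hm.symm_right _ _ _).symm, (hm.symm_left _ _ _).symm, (hm.rotate _ _ _).symm,
      hm.rotate _ _ _, (hm.swap _ _ _).symm⟩
  obtain ⟨a1, a2, a3, a4, a5⟩ := perm _ _ _ _ hx
  obtain ⟨b1, b2, b3, b4, b5⟩ := perm _ _ _ _ hr
  obtain ⟨c1, c2, c3, c4, c5⟩ := perm _ _ _ _ hp
  obtain ⟨d1, d2, d3, d4, d5⟩ := perm _ _ _ _ hq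
  have hg : ∀ i j i' j' : Bool, g i j = g i' j' → i = i' ∧ j = j' := by
    intro i j i' j' h
    cases i <;> cases j <;> cases i' <;> cases j' <;> simp_all [g]
  have hom : ∀ i j i' j' i'' j'' : Bool, g (majority i i' i'') (majority j j' j'') =
      m (g i j) (g i' j') (g i'' j'') := by
    intro i j i' j' i'' j''
    cases i <;> cases j <;> cases i' <;> cases j' <;> cases i'' <;> cases j'' <;>
      simp only [g, majority, Bool.and_true, Bool.and_false, Bool.or_true, Bool.or_false,
        cond_true, cond_false, hm.localisation, hm.loc_outer, hm.loc_right, hx, a1, a2, a3, a4, a5,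
        hr, b1, b2, b3, b4, b5, hp, c1, c2, c3, c4, c5, hq, d1, d2, d3, d4, d5]
  refine ⟨fun v => g (v 0) (v 1), fun v w h => ?_, fun u v w => hom _ _ _ _ _ _⟩
  obtain ⟨h0, h1⟩ := hg _ _ _ _ h
  funext i
  fin_cases i
  · exact h0
  · exact h1

/-- In a median algebra of rank at most one, triangles are tripods. -/
theorem interval_subset_union (hm : IsMedianAlgebra m) (hrank : medianRank m ≤ 1) {a b x : P}
    (hx : m a b x = x) (c : P) : m a c x = x ∨ m b c x = x := by
  by_contra! h
  obtain ⟨h1, h2⟩ := h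
  -- If `x` is on neither side, it spans a square with its projections `p`, `q` to the two sides and
  -- the opposite corner `m p q c`.
  set p := m a c x with hp
  set q := m b c x with hq
  have hpx : m a x p = p := hm.median_mem a c x
  have hqx : m b x q = q := hm.median_mem b c x
  have hcp : m c x p = p := by rw [hp, hm.symm_left a c x]; exact hm.median_mem c a x
  have hcq : m c x q = q := by rw [hq, hm.symm_left b c x]; exact hm.median_mem c b x
  have hx1 : m p b x = x := hm.chain hpx hx
  have hx2 : m q p x = x := hm.chain hqx (by rw [hm.symm_left, hx1])
  have hrp : m c p (m p q c) = m p q c := by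
    rw [← hm.rotate c p q, hm.symm_right c p q, hm.median_mem]
  have hrq : m c q (m p q c) = m p q c := by
    rw [← hm.rotate c p q, hm.median_mem]
  have hp3 : m (m p q c) x p = p := hm.chain hrp hcp
  have hq3 : m (m p q c) x q = q := hm.chain hrq hcq
  have hr : m p q (m p q c) = m p q c := by
    rw [hm.symm_right p q c, hm.median_mem]
  have hcube : ContainsCube m 2 :=
    hm.containsCube_two (by rw [hm.symm_left, hx2]) hr (by rw [hm.symm_left, hp3])
      (by rw [hm.symm_left, hq3]) h1.symm h2.symm
  have h2le : (2 : ℕ∞) ≤ medianRank m :=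
    le_iSup₂_of_le (f := fun (n : ℕ) (_ : ContainsCube m n) => (n : ℕ∞)) 2 hcube le_rfl
  exact absurd (h2le.trans hrank) (by norm_num)

/-- In a median algebra of rank at most one, if `x` and `y` have different projections to an
interval, then the projection of `x` lies between `x` and `y`. -/
theorem projection_dichotomy (hm : IsMedianAlgebra m) (hrank : medianRank m ≤ 1) (a b x y : P) :
    m a b x = m a b y ∨ m x y (m a b x) = m a b x := by
  by_cases h : m x y (m a b x) = m a b x
  · exact Or.inr h
  left
  have hab : m a b (m a b x) = m a b x := by rw [hm.symm_right a b x, hm.median_mem]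
  have hax : m a x (m a b x) = m a b x := hm.median_mem a b x
  have hbx : m b x (m a b x) = m a b x := by rw [hm.symm_left a b x, hm.median_mem]
  have hay := (hm.interval_subset_union hrank hax y).resolve_right h
  have hby := (hm.interval_subset_union hrank hbx y).resolve_right h
  exact hm.eq_median hab hay hby

/-- A point `z` of the interval from `a` to `b` separates the interval from `a` to `z` from the
interval from `z` to `b`. -/
theorem median_between (hm : IsMedianAlgebra m) {a b z : P} (hz : m a b z = z) (p q : P) :
    m (m a z p) (m z b q) z = z := by
  have h1 : m a z (m a z p) = m a z p := by rw [hm.symm_right a z p, hm.median_mem]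
  have h2 : m b z (m z b q) = m z b q := by
    rw [hm.symm_left z b q, hm.symm_right b z q, hm.median_mem]
  have h3 := hm.chain h1 hz
  have h4 := hm.chain h2 (by rw [hm.symm_left, h3])
  rw [hm.symm_left, h4]

end IsMedianAlgebra

/-! ### Transfer to coarse median spaces -/

variable {X : Type*} [MetricSpace X] {μ : X → X → X → X}

/-- Five points are approximated by a median algebra of rank at most one, with errors that depend
only on the depth of the median terms considered. -/
theorem exists_model (hmed : IsCoarseMedianSpace X μ) (hrank : RankAtMost X μ 1) :
    ∃ C : ℕ → ℝ, (∀ n, 0 ≤ C n) ∧ Monotone C ∧ ∀ a b c d e : X,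
      ∃ (P : Type) (m : P → P → P → P) (l : P → X) (a' b' c' d' e' : P),
        IsMedianAlgebra m ∧ medianRank m ≤ 1 ∧
        (dist (l a') a ≤ C 0 ∧ dist (l b') b ≤ C 0 ∧ dist (l c') c ≤ C 0 ∧
          dist (l d') d ≤ C 0 ∧ dist (l e') e ≤ C 0) ∧
        ∀ (n : ℕ) (u v w : P) (x y z : X), dist (l u) x ≤ C n → dist (l v) y ≤ C n →
          dist (l w) z ≤ C n → dist (l (m u v w)) (μ x y z) ≤ C (n + 1) := by
  classical
  obtain ⟨K, H₀, hK, hH₀, hctl⟩ := hmed.control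
  obtain ⟨H, hH, happ⟩ := hrank
  set h := H 5
  have hh : 0 ≤ h := hH 5
  -- One more median multiplies the error by `3 * K` and adds `h + H₀`; the extra summand `e` makes
  -- `C` monotone.
  let C : ℕ → ℝ := fun n => Nat.rec h (fun _ e => e + (3 * K * e + h + H₀)) n
  have hC0 : C 0 = h := rfl
  have hCs : ∀ n, C (n + 1) = C n + (3 * K * C n + h + H₀) := fun n => rfl
  have hC : ∀ n, 0 ≤ C n := by
    intro n
    induction n with
    | zero => exact hh
    | succ n ih => rw [hCs]; positivity
  refine ⟨C, hC, monotone_nat_of_le_succ fun n => ?_, fun a b c d e => ?_⟩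
  · have := hC n
    rw [hCs]
    exact le_add_of_nonneg_right (by positivity)
  obtain ⟨P, m, p, l, hP, hr⟩ :=
    happ 5 {a, b, c, d, e} ⟨a, by simp⟩ Finset.card_le_five
  refine ⟨P, m, l, p ⟨a, by simp⟩, p ⟨b, by simp⟩, p ⟨c, by simp⟩, p ⟨d, by simp⟩,
    p ⟨e, by simp⟩, hP.median, by simpa using hr,
    ⟨hP.close _, hP.close _, hP.close _, hP.close _, hP.close _⟩, ?_⟩
  intro n u v w x y z hu hv hw
  have h1 := hP.quasi_morphism u v w
  have h2 := hctl (l u) (l v) (l w) x y z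
  have h3 : K * (dist (l u) x + dist (l v) y + dist (l w) z) ≤ K * (C n + C n + C n) := by
    gcongr
  have h4 := dist_triangle (l (m u v w)) (μ (l u) (l v) (l w)) (μ x y z)
  rw [hCs]
  nlinarith [hC n]

/-- Coarse intervals form thin triangles. -/
theorem exists_thin (hmed : IsCoarseMedianSpace X μ) (hrank : RankAtMost X μ 1) :
    ∃ C : ℝ, 0 ≤ C ∧ ∀ a b c x : X,
      dist (μ a c (μ a b x)) (μ a b x) ≤ C ∨ dist (μ b c (μ a b x)) (μ a b x) ≤ C := by
  obtain ⟨C, hC, hmono, hmod⟩ := exists_model hmed hrank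
  refine ⟨C 2 + C 1, add_nonneg (hC _) (hC _), fun a b c x => ?_⟩
  obtain ⟨P, m, l, a', b', c', x', -, hm, hr, ⟨ha, hb, hc, hx, -⟩, hl⟩ := hmod a b c x x
  have h01 : C 0 ≤ C 1 := hmono (by norm_num)
  have hz := hl 0 a' b' x' a b x ha hb hx
  have hab : m a' b' (m a' b' x') = m a' b' x' := by rw [hm.symm_right a' b' x', hm.median_mem]
  rcases hm.interval_subset_union hr hab c' with h | h
  · left
    have h1 := hl 1 a' c' (m a' b' x') a c (μ a b x) (ha.trans h01) (hc.trans h01) hz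
    rw [h] at h1
    exact (dist_triangle_left _ _ _).trans (add_le_add h1 hz)
  · right
    have h1 := hl 1 b' c' (m a' b' x') b c (μ a b x) (hb.trans h01) (hc.trans h01) hz
    rw [h] at h1
    exact (dist_triangle_left _ _ _).trans (add_le_add h1 hz)

/-- The projection to a coarse interval is strongly contracting. -/
theorem exists_contracting (hmed : IsCoarseMedianSpace X μ) (hrank : RankAtMost X μ 1) :
    ∃ C K : ℝ, 0 ≤ C ∧ 0 ≤ K ∧ ∀ a b x y : X,
      dist (μ a b x) (μ a b y) ≤ C ∨
        (dist x (μ a b x) ≤ K * dist x y + C ∧ dist y (μ a b y) ≤ K * dist x y + C) := by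
  obtain ⟨C, hC, hmono, hmod⟩ := exists_model hmed hrank
  obtain ⟨K, H₀, hK, hH₀, hctl⟩ := hmed.control
  have key : ∀ a b x y : X, dist (μ a b x) (μ a b y) ≤ C 2 + C 1 + H₀ ∨
      dist x (μ a b x) ≤ K * dist x y + (C 2 + C 1 + H₀) := by
    intro a b x y
    obtain ⟨P, m, l, a', b', x', y', -, hm, hr, ⟨ha, hb, hx, hy, -⟩, hl⟩ := hmod a b x y x
    have h01 : C 0 ≤ C 1 := hmono (by norm_num)
    have h12 : C 1 ≤ C 2 := hmono (by norm_num)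
    have hp := hl 0 a' b' x' a b x ha hb hx
    have hq := hl 0 a' b' y' a b y ha hb hy
    rcases hm.projection_dichotomy hr a' b' x' y' with h | h
    · left
      rw [← h] at hq
      have := dist_triangle_left (μ a b x) (μ a b y) (l (m a' b' x'))
      linarith
    · right
      have h1 := hl 1 x' y' _ x y _ (hx.trans h01) (hy.trans h01) hp
      rw [h] at h1
      have h2 := dist_triangle_left (μ x y (μ a b x)) (μ a b x) (l (m a' b' x'))
      -- The projection is nearly `μ x y (μ a b x)`, which is near `μ x x (μ a b x) = x` when `y` is
      -- near `x`.
      have h3 := hctl x x (μ a b x) x y (μ a b x)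
      rw [hmed.localisation, dist_self, dist_self, zero_add, add_zero] at h3
      have h4 := dist_triangle x (μ x y (μ a b x)) (μ a b x)
      linarith
  refine ⟨C 2 + C 1 + H₀, K, by have := hC 2; have := hC 1; positivity, hK, fun a b x y => ?_⟩
  rcases key a b x y with h | h
  · exact Or.inl h
  rcases key a b y x with h' | h'
  · left
    rwa [dist_comm]
  · right
    rw [dist_comm y x] at h'
    exact ⟨h, h'⟩

/-- Coarse form of the separation property of points of an interval. -/
theorem exists_between (hmed : IsCoarseMedianSpace X μ) (hrank : RankAtMost X μ 1) :
    ∃ C : ℝ, 0 ≤ C ∧ ∀ a b x p q : X,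
      dist (μ (μ a (μ a b x) p) (μ (μ a b x) b q) (μ a b x)) (μ a b x) ≤ C := by
  obtain ⟨C, hC, hmono, hmod⟩ := exists_model hmed hrank
  refine ⟨C 3 + C 1, add_nonneg (hC _) (hC _), fun a b x p q => ?_⟩
  obtain ⟨P, m, l, a', b', x', p', q', hm, -, ⟨ha, hb, hx, hp, hq⟩, hl⟩ := hmod a b x p q
  have h01 : C 0 ≤ C 1 := hmono (by norm_num)
  have h12 : C 1 ≤ C 2 := hmono (by norm_num)
  have hz := hl 0 a' b' x' a b x ha hb hx
  have h1 := hl 1 a' _ p' a _ p (ha.trans h01) hz (hp.trans h01)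
  have h2 := hl 1 _ b' q' _ b q hz (hb.trans h01) (hq.trans h01)
  have h3 := hl 2 _ _ _ _ _ _ h1 h2 (hz.trans h12)
  have hab : m a' b' (m a' b' x') = m a' b' x' := by rw [hm.symm_right a' b' x', hm.median_mem]
  rw [hm.median_between hab] at h3
  exact (dist_triangle_left _ _ _).trans (add_le_add h3 hz)

/-! ### Coarse paths and geodesics against coarse intervals -/

/-- A point of the coarse interval from `a` to `b` is close to the projection of one of the points
of any coarsely connected path from `a` to `b`. -/
theorem exists_close_projection (hmed : IsCoarseMedianSpace X μ) (hrank : RankAtMost X μ 1)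
    (r : ℝ) :
    ∃ D : ℝ, ∀ (a b x : X) (n : ℕ) (c : ℕ → X), c 0 = a → c n = b →
      (∀ i, dist (c i) (c (i + 1)) ≤ r) →
        ∃ i, dist (μ a b x) (μ a b (c i)) ≤ D := by
  classical
  obtain ⟨T, hT, hthin⟩ := exists_thin hmed hrank
  obtain ⟨B, hB, hbet⟩ := exists_between hmed hrank
  obtain ⟨K, H₀, hK, hH₀, hctl⟩ := hmed.control
  let E := K * r + H₀
  -- `E` bounds one projected step; the `0` serves the case `p = q` below.
  refine ⟨B + (K * (T + (T + max E 0)) + H₀), ?_⟩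
  intro a b x n c hc0 hcn hc
  set z := μ a b x with hz
  have hb : μ a b b = b := by
    rw [hmed.symm_left, hmed.symm_right, hmed.localisation]
  have ha : μ a b a = a := by
    rw [hmed.symm_right, hmed.localisation]
  have close : ∀ p q : X, dist (μ a z p) p ≤ T → dist (μ z b q) q ≤ T →
      dist p q ≤ max E 0 → dist z p ≤ B + (K * (T + (T + max E 0)) + H₀) := by
    intro p q hp hq hpq
    have h1 := hbet a b x p q
    rw [← hz] at h1
    have h2 := hctl (μ a z p) (μ z b q) z p p z
    rw [hmed.localisation p, dist_self, add_zero] at h2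
    have h3 : dist (μ z b q) p ≤ T + max E 0 := by
      have := dist_triangle_right (μ z b q) p q
      linarith
    have h4 : K * (dist (μ a z p) p + dist (μ z b q) p) ≤ K * (T + (T + max E 0)) := by gcongr
    have h5 := dist_triangle_left z p (μ (μ a z p) (μ z b q) z)
    linarith
  -- At the first projection on the `b` side of `z`, the preceding one is on the `a` side by
  -- thinness.
  have hex : ∃ i, dist (μ z b (μ a b (c i))) (μ a b (c i)) ≤ T := by
    refine ⟨n, ?_⟩
    rw [hcn, hb, hmed.symm_left, hmed.symm_right, hmed.localisation, dist_self]
    exact hT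
  rcases Nat.eq_zero_or_eq_succ_pred (Nat.find hex) with hi | hj
  · refine ⟨0, close _ _ ?_ (hi ▸ Nat.find_spec hex) (by simp)⟩
    rw [hc0, ha, hmed.symm_right, hmed.localisation, dist_self]
    exact hT
  · set j := (Nat.find hex).pred
    have hlt : ¬ dist (μ z b (μ a b (c j))) (μ a b (c j)) ≤ T := Nat.find_min hex (by omega)
    have hspec := Nat.find_spec hex
    rw [hj] at hspec
    have hj' : dist (μ a z (μ a b (c j))) (μ a b (c j)) ≤ T := by
      refine (hthin a b z (c j)).resolve_right ?_
      rwa [hmed.symm_left b z]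
    refine ⟨j, close _ _ hj' hspec (le_max_of_le_left ?_)⟩
    have h := hctl a b (c j) a b (c (j + 1))
    rw [dist_self, dist_self, zero_add, zero_add] at h
    exact h.trans (by simp only [E]; gcongr; exact hc j)

/-- A sequence of points along a geodesic, at distance `r` from one to the next, that stays at the
end of the geodesic after reaching it. -/
def sample (γ : ℝ → X) (L r : ℝ) (i : ℕ) : X := γ (min (i * r) L)

theorem IsGeodesic.dist_sample {γ : ℝ → X} {a b : X} (hγ : IsGeodesic γ a b) {r : ℝ} (hr : 0 ≤ r)
    (i j : ℕ) : dist (sample γ (dist a b) r i) (sample γ (dist a b) r j) =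
      |min (i * r) (dist a b) - min (j * r) (dist a b)| :=
  hγ.isometric _ ⟨le_min (by positivity) dist_nonneg, min_le_right _ _⟩ _
    ⟨le_min (by positivity) dist_nonneg, min_le_right _ _⟩

theorem IsGeodesic.dist_sample_succ_le {γ : ℝ → X} {a b : X} (hγ : IsGeodesic γ a b) {r : ℝ}
    (hr : 0 ≤ r) (i : ℕ) :
    dist (sample γ (dist a b) r i) (sample γ (dist a b) r (i + 1)) ≤ r := by
  rw [hγ.dist_sample hr]
  refine (abs_min_sub_min_le_max _ _ _ _).trans ?_
  rw [sub_self, abs_zero, max_eq_left (abs_nonneg _)]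
  push_cast
  rw [show (i : ℝ) * r - (i + 1) * r = -r by ring, abs_neg, abs_of_nonneg hr]

theorem IsGeodesic.sample_zero {γ : ℝ → X} {a b : X} (hγ : IsGeodesic γ a b) (r : ℝ) :
    sample γ (dist a b) r 0 = a := by
  simp [sample, hγ.source]

theorem IsGeodesic.sample_of_le {γ : ℝ → X} {a b : X} (hγ : IsGeodesic γ a b) {r : ℝ} {n : ℕ}
    (h : dist a b ≤ n * r) : sample γ (dist a b) r n = b := by
  rw [sample, min_eq_right h, hγ.target]

/-- Geodesics stay close to coarse intervals. -/
theorem exists_geodesic_close (hmed : IsCoarseMedianSpace X μ) (hrank : RankAtMost X μ 1) :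
    ∃ R : ℝ, 0 ≤ R ∧ ∀ (a b : X) (γ : ℝ → X), IsGeodesic γ a b → ∀ s ∈ Set.Icc 0 (dist a b),
      dist (γ s) (μ a b (γ s)) ≤ R := by
  classical
  obtain ⟨C, K, hC, hK, hcon⟩ := exists_contracting hmed hrank
  obtain ⟨K', H₀, hK', hH₀, hctl⟩ := hmed.control
  -- Each step outruns the contraction bound `C` by one; beyond distance `N` only the contracting
  -- alternative survives.
  set r := C + 1 with hr
  have hr0 : 0 < r := by positivity
  set N := K * r + C with hN
  have hN0 : 0 ≤ N := by positivity
  set M := (2 * N + r + 1) * r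
  have hM0 : 0 ≤ M := by positivity
  refine ⟨M + N + (K' * M + H₀), by positivity, ?_⟩
  intro a b γ hγ s hs
  set c := sample γ (dist a b) r with hc
  obtain ⟨n, hn⟩ := exists_nat_ge (dist a b / r)
  rw [div_le_iff₀ hr0] at hn
  set f : ℕ → Prop := fun i => dist (c i) (μ a b (c i)) ≤ N with hf
  have f0 : f 0 := by
    simp only [hf, hc, hγ.sample_zero]
    rwa [hmed.symm_right, hmed.localisation, dist_self]
  have fn : ∀ k, n ≤ k → f k := by
    intro k hk
    have : dist a b ≤ k * r := hn.trans (by gcongr)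
    simp only [hf, hc, hγ.sample_of_le this]
    rwa [hmed.symm_left, hmed.symm_right, hmed.localisation, dist_self]
  set k := ⌊s / r⌋₊
  have hks : k * r ≤ s := by
    rw [← le_div_iff₀ hr0]; exact Nat.floor_le (div_nonneg hs.1 hr0.le)
  have hsk : s < (k + 1) * r := by
    rw [← div_lt_iff₀ hr0]; exact Nat.lt_floor_add_one _
  -- `i` and `j` are the samples near the interval that enclose the excursion around `γ s`.
  set i := Nat.findGreatest f k
  have hik : i ≤ k := Nat.findGreatest_le k
  have hfi : f i := Nat.findGreatest_spec (Nat.zero_le k) f0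
  have hex : ∃ j, k < j ∧ f j := ⟨max n (k + 1), by omega, fn _ (le_max_left _ _)⟩
  set j := Nat.find hex
  obtain ⟨hkj, hfj⟩ : k < j ∧ f j := Nat.find_spec hex
  have hbad : ∀ t, i < t → t < j → ¬ f t := by
    intro t h1 h2
    rcases le_or_gt t k with h | h
    · exact Nat.findGreatest_is_greatest h1 h
    · exact fun hft => Nat.find_min hex h2 ⟨h, hft⟩
  have hik' : ((k - i : ℕ) : ℝ) ≤ 2 * N + r := by
    rcases hik.eq_or_lt with h | h
    · rw [← h, Nat.sub_self]; push_cast; positivity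
    have hstep : ∀ t, i ≤ t → t < j → dist (μ a b (c t)) (μ a b (c (t + 1))) ≤ C := by
      intro t h1 h2
      have hd := hγ.dist_sample_succ_le hr0.le t
      rw [← hc] at hd
      have hKd : K * dist (c t) (c (t + 1)) + C ≤ N := by rw [hN]; gcongr
      refine (hcon a b (c t) (c (t + 1))).resolve_right ?_
      rintro ⟨h3, h4⟩
      rcases h1.eq_or_lt with h5 | h5
      · exact hbad (t + 1) (by omega) (by omega) (h4.trans hKd)
      · exact hbad t h5 h2 (h3.trans hKd)
    have hsum : ∀ t, i ≤ t → t ≤ j → dist (μ a b (c i)) (μ a b (c t)) ≤ C * (t - i) := by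
      intro t h1
      induction t, h1 using Nat.le_induction with
      | base => intro _; simp
      | succ t h1 ih =>
        intro h2
        have h3 := ih (by omega)
        have h4 := hstep t h1 (by omega)
        have h5 := dist_triangle (μ a b (c i)) (μ a b (c t)) (μ a b (c (t + 1)))
        push_cast
        linarith
    have hij := hsum j (by omega) le_rfl
    -- Sample `j` may be truncated at `b`, so only `j - 1` steps count in full. This costs the `r`
    -- in `2 * N + r`.
    have hjD : ((j : ℝ) - 1) * r ≤ dist a b := by
      rcases hkj.nat_succ_le.eq_or_lt with h1 | h1
      · rw [← h1]
        push_cast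
        rw [add_sub_cancel_right]
        exact hks.trans hs.2
      · by_contra! h2
        refine hbad (j - 1) (by omega) (by omega) ?_
        have h3 : dist a b ≤ (j - 1 : ℕ) * r := by
          rw [Nat.cast_sub (by omega), Nat.cast_one]
          exact h2.le
        simp only [hf, hc, hγ.sample_of_le h3]
        rwa [hmed.symm_left, hmed.symm_right, hmed.localisation, dist_self]
    have hiD : (i : ℝ) * r ≤ dist a b := by
      have : (i : ℝ) * r ≤ k * r := by gcongr
      linarith [hs.2]
    have hlow : ((j : ℝ) - 1) * r - i * r ≤ dist (c i) (c j) := by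
      rw [hc, hγ.dist_sample hr0.le, min_eq_left hiD, abs_sub_comm]
      refine le_trans (sub_le_sub_right (le_min ?_ hjD) _) (le_abs_self _)
      gcongr
      linarith
    have h2 : dist (c i) (c j) ≤ N + (C * (j - i) + N) := by
      have h3 := dist_triangle4 (c i) (μ a b (c i)) (μ a b (c j)) (c j)
      rw [dist_comm (μ a b (c j)) (c j)] at h3
      simp only [hf] at hfi hfj
      linarith
    have h3 : ((k - i : ℕ) : ℝ) ≤ j - i := by
      rw [Nat.cast_sub hik]
      gcongr
    have h4 : ((j : ℝ) - i) * r = C * (j - i) + (j - i) := by rw [hr]; ring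
    linarith
  have hsi : dist (γ s) (c i) ≤ M := by
    have hiD : (i : ℝ) * r ≤ s := le_trans (by gcongr) hks
    rw [hc, sample, min_eq_left (hiD.trans hs.2),
      hγ.isometric s hs _ ⟨by positivity, hiD.trans hs.2⟩, abs_of_nonneg (sub_nonneg.2 hiD)]
    rw [Nat.cast_sub hik] at hik'
    have : ((k : ℝ) + 1 - i) * r ≤ (2 * N + r + 1) * r := by gcongr; linarith
    linarith
  have h1 := hctl a b (c i) a b (γ s)
  rw [dist_self, dist_self, zero_add, zero_add, dist_comm (c i)] at h1
  have h2 : K' * dist (γ s) (c i) ≤ K' * M := by gcongr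
  have h3 := dist_triangle4 (γ s) (c i) (μ a b (c i)) (μ a b (γ s))
  simp only [hf] at hfi
  linarith

/-- A point of the coarse interval from `a` to `b` is close to any geodesic from `a` to `b`. -/
theorem exists_interval_close (hmed : IsCoarseMedianSpace X μ) (hrank : RankAtMost X μ 1) :
    ∃ D : ℝ, ∀ (a b : X) (γ : ℝ → X), IsGeodesic γ a b → ∀ x : X,
      ∃ t ∈ Set.Icc 0 (dist a b), dist (μ a b x) (γ t) ≤ D := by
  obtain ⟨R, hR, hclose⟩ := exists_geodesic_close hmed hrank
  obtain ⟨D, hD⟩ := exists_close_projection hmed hrank 1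
  refine ⟨D + R, fun a b γ hγ x => ?_⟩
  obtain ⟨n, hn⟩ := exists_nat_ge (dist a b)
  obtain ⟨i, hi⟩ := hD a b x n (sample γ (dist a b) 1) (hγ.sample_zero 1)
    (hγ.sample_of_le (by rwa [mul_one])) (hγ.dist_sample_succ_le zero_le_one)
  have ht : min ((i : ℝ) * 1) (dist a b) ∈ Set.Icc 0 (dist a b) :=
    ⟨le_min (by positivity) dist_nonneg, min_le_right _ _⟩
  refine ⟨_, ht, ?_⟩
  have h1 := hclose a b γ hγ _ ht
  rw [dist_comm] at h1
  exact (dist_triangle _ _ _).trans (add_le_add hi h1)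

end CoarseMedian

/-! ### Slim geodesic triangles -/

open CoarseMedian in
theorem mainTheorem4 {X : Type*} [MetricSpace X] (μ : X → X → X → X)
    (hgeo : CoarseMedian.IsGeodesicSpace X)
    (hmed : CoarseMedian.IsCoarseMedianSpace X μ)
    (hrank : CoarseMedian.RankAtMost X μ 1) :
    CoarseMedian.IsHyperbolic X := by
  obtain ⟨R, hR, hclose⟩ := exists_geodesic_close hmed hrank
  obtain ⟨T, hT, hthin⟩ := exists_thin hmed hrank
  obtain ⟨D, hD⟩ := exists_interval_close hmed hrank
  refine ⟨max (R + T + D) 0, le_max_right _ _, fun x y z α β γ hα hβ hγ s hs => ?_⟩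
  have h1 := hclose x y α hα s hs
  have near : ∀ p q : X, dist p (μ x y (α s)) ≤ T → dist p q ≤ D →
      dist (α s) q ≤ max (R + T + D) 0 := by
    intro p q h2 h3
    refine le_max_of_le_left ?_
    rw [dist_comm] at h2
    have h5 := dist_triangle4 (α s) (μ x y (α s)) p q
    linarith
  rcases hthin x y z (α s) with h | h
  · obtain ⟨t, ht, htD⟩ := hD x z γ hγ (μ x y (α s))
    exact Or.inr ⟨t, ht, near _ _ h htD⟩
  · obtain ⟨t, ht, htD⟩ := hD y z β hβ (μ x y (α s))
    exact Or.inl ⟨t, ht, near _ _ h htD⟩
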